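/- Let $d \ge 3$ be an integer. For every constant $C > 0$ there is a constant $c > 0$, depending only on $C$ and $d$, such that the following holds for every prime power $q$. Let $B$ be a non-degenerate bilinear form on $\mathbb{F}_q^d$, and let $E \subset \mathbb{F}_q^d$ satisfy $|E| \ge C\, q^{d - \frac{d-1}{3}}$. Then $$\bigl|\{(B(x,y),\, B(y,z),\, B(z,x)) : x, y, z \in E\}\bigr| \ge c\, q^3 .$$ -/

import Mathlib

/-!
Write `n = |E|`, `q = |F|` and let `V` be the ambient space. A pair `(x, y)` in `E × E` gives rise
to many triples `(B(x,y), B(y,z), B(z,x))`, all with the same first coordinate, as soon as few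
pairs `(z, z')` collide, that is, satisfy `B(y, z - z') = 0 = B(z - z', x)`: by Cauchy-Schwarz the
number of triples is at least `n²` divided by the number of collisions. So it suffices to find
`≥ n² / 2` pairs `(x, y)` which have `≪ n² / q²` collisions on average, and of which only
`≪ n² / q` lie on each level set of `B` (`card_tripleSet_ge`).

Both points rest on second moments. The functions `x ↦ 1[B(x,y) = a] - 1/q` and
`x ↦ 1[B(x,y') = a] - 1/q` are orthogonal on `V` unless `y, y'` are proportional
(`correlation_eq_zero`). Hence the variance over `V` of the number of `y ∈ E` with `B(x,y) = a` is
under control (`variance_le`, `variance_le_of_ne_zero`); this bounds the level sets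
(`level_bounds`). Collisions are counted by summing over `(z, z')` the number of pairs `(x, y)`
which are orthogonal to `w = z - z'`, a product of two such slice counts.

* Each `w` is a difference of at most `n` pairs `(z, z')`, so the variance bound gives
  `≪ n⁴ / q² + n² |V|` collisions in all (`sum_card_collisions_le`). This is enough if
  `n ≫ q ^ (d / 2 + 1)`, which holds for `d ≥ 4`.
* For `d = 3`, call `w` rich if it is orthogonal to more than `4 n² / q²` pairs. Discarding the
  pairs orthogonal to a nonzero rich `w` leaves `≪ n⁴ / q²` collisions. By the variance bound
  few `w` are rich, and as richness depends only on the line through `w`, only `≪ n |V| / q` pairs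
  are discarded (`card_orthogonal_rich_le`), a small part of all since `n` is large against `q²`.
-/

/-! ### Second moments of slice sizes -/

open Finset Classical in
/-- Averaging over translates by a vector on which `g` vanishes and `f` does not. -/
theorem sum_mul_eq_zero_of_not_smul {F V : Type*} [Field F] [Fintype F] [AddCommGroup V]
    [Module F V] [Fintype V] {f g : V →ₗ[F] F} (hfg : ∀ r : F, f ≠ r • g)
    {h : F → ℝ} (k : F → ℝ) (hh : ∑ s, h s = 0) : ∑ x, h (f x) * k (g x) = 0 := by
  obtain ⟨x₀, hg, hf⟩ : ∃ x₀, g x₀ = 0 ∧ f x₀ ≠ 0 := by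
    by_contra! H
    have hker : ⨅ _ : Unit, LinearMap.ker g ≤ LinearMap.ker f := by
      intro x hx
      simp only [Submodule.mem_iInf, LinearMap.mem_ker, forall_const] at hx ⊢
      exact H x hx
    have := mem_span_of_iInf_ker_le_ker (L := fun _ : Unit => g) hker
    simp only [Set.range_const, Submodule.mem_span_singleton] at this
    obtain ⟨r, hr⟩ := this
    exact hfg r hr.symm
  have key : ∀ s : F, ∑ x, h (f x + s * f x₀) * k (g x) = ∑ x, h (f x) * k (g x) := by
    intro s
    rw [← Equiv.sum_comp (Equiv.addRight (s • x₀)) (fun x => h (f x) * k (g x))]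
    simp [hg]
  have hsum : ∑ s : F, ∑ x, h (f x + s * f x₀) * k (g x) = 0 := by
    rw [sum_comm]
    refine sum_eq_zero fun x _ => ?_
    rw [← sum_mul]
    have : ∑ s, h (f x + s * f x₀) = ∑ s, h s :=
      ((Equiv.mulRight₀ (f x₀) hf).trans (Equiv.addLeft (f x))).sum_comp h
    rw [this, hh, zero_mul]
  simp only [key, sum_const, card_univ, nsmul_eq_mul] at hsum
  exact (mul_eq_zero.mp hsum).resolve_left (by exact_mod_cast Fintype.card_ne_zero)

open Finset Classical in
theorem card_mul_sum_comp {F V : Type*} [Field F] [Fintype F] [AddCommGroup V]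
    [Module F V] [Fintype V] {f : V →ₗ[F] F} (hf : f ≠ 0) (k : F → ℝ) :
    (Fintype.card F : ℝ) * ∑ x, k (f x) = Fintype.card V * ∑ s, k s := by
  obtain ⟨x₀, hx₀⟩ : ∃ x₀, f x₀ ≠ 0 := by
    by_contra! H
    exact hf (LinearMap.ext H)
  have key : ∀ s : F, ∑ x, k (f x + s * f x₀) = ∑ x, k (f x) := by
    intro s
    rw [← Equiv.sum_comp (Equiv.addRight (s • x₀)) (fun x => k (f x))]
    simp
  have hsum : ∑ s : F, ∑ x, k (f x + s * f x₀) = Fintype.card V * ∑ s, k s := by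
    rw [sum_comm]
    have : ∀ x, ∑ s, k (f x + s * f x₀) = ∑ s, k s := fun x =>
      ((Equiv.mulRight₀ (f x₀) hx₀).trans (Equiv.addLeft (f x))).sum_comp k
    simp [this]
  simpa [key] using hsum

open Classical in
/-- The indicator function of `a` in a finite field, shifted by a constant so as to have sum `0`. -/
noncomputable def balancedIndicator {F : Type*} [Fintype F] (a s : F) : ℝ :=
  (if s = a then 1 else 0) - 1 / Fintype.card F

theorem sum_balancedIndicator {F : Type*} [Field F] [Fintype F] (a : F) :
    ∑ s, balancedIndicator a s = 0 := by
  classical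
  have : (Fintype.card F : ℝ) ≠ 0 := by exact_mod_cast Fintype.card_ne_zero
  simp [balancedIndicator, this]

theorem sum_balancedIndicator_sq_le {F : Type*} [Field F] [Fintype F] (a : F) :
    ∑ s, balancedIndicator a s ^ 2 ≤ 1 := by
  classical
  have hq : (0 : ℝ) < Fintype.card F := by exact_mod_cast Fintype.card_pos
  have h : ∀ s, balancedIndicator a s ^ 2 =
      (if s = a then 1 - 2 / (Fintype.card F : ℝ) else 0) + 1 / (Fintype.card F : ℝ) ^ 2 := by
    intro s
    unfold balancedIndicator
    split_ifs <;> ring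
  simp only [h, Finset.sum_add_distrib, Finset.sum_ite_eq', Finset.mem_univ, if_true,
    Finset.sum_const, Finset.card_univ, nsmul_eq_mul]
  have : (Fintype.card F : ℝ) * (1 / (Fintype.card F : ℝ) ^ 2) = 1 / Fintype.card F := by
    field_simp
  rw [this]
  have : 2 / (Fintype.card F : ℝ) = 2 * (1 / Fintype.card F) := by ring
  have : 0 < 1 / (Fintype.card F : ℝ) := by positivity
  linarith

/-- The number of `y ∈ E` with `B x y = a`. -/
noncomputable def sliceCard {F V : Type*} [Field F] [AddCommGroup V] [Module F V]
    (B : LinearMap.BilinForm F V) (E : Finset V) (a : F) (x : V) : ℝ :=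
  open Classical in ((E.filter fun y => B x y = a).card : ℝ)

theorem sliceCard_sub {F V : Type*} [Field F] [Fintype F] [AddCommGroup V] [Module F V]
    (B : LinearMap.BilinForm F V) (E : Finset V) (a : F) (x : V) :
    sliceCard B E a x - E.card / Fintype.card F = ∑ y ∈ E, balancedIndicator a (B x y) := by
  classical
  simp only [sliceCard, balancedIndicator, Finset.sum_sub_distrib, Finset.sum_const, nsmul_eq_mul]
  simp [div_eq_mul_inv]

section Variance

variable {F V : Type*} [Field F] [Fintype F] [AddCommGroup V] [Module F V] [Fintype V]
  {B : LinearMap.BilinForm F V}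

open Finset in
theorem sum_sliceCard_sub_sq (E : Finset V) (a : F) :
    ∑ x, (sliceCard B E a x - E.card / Fintype.card F) ^ 2 =
      ∑ y ∈ E, ∑ y' ∈ E, ∑ x, balancedIndicator a (B x y) * balancedIndicator a (B x y') := by
  simp only [sliceCard_sub, sq, sum_mul_sum]
  rw [sum_comm]
  exact sum_congr rfl fun y _ => sum_comm

theorem correlation_eq_zero (hB : B.Nondegenerate) {a : F} {y y' : V}
    (h : ∀ r : F, y' ≠ r • y) :
    ∑ x, balancedIndicator a (B x y) * balancedIndicator a (B x y') = 0 := by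
  simp only [mul_comm (balancedIndicator a (B _ y))]
  refine sum_mul_eq_zero_of_not_smul (f := LinearMap.flip B y') (g := LinearMap.flip B y)
    (fun r hr => h r ?_)
    (balancedIndicator a) (sum_balancedIndicator a)
  refine sub_eq_zero.mp (hB.2 _ fun x => ?_)
  have := LinearMap.congr_fun hr x
  simp only [LinearMap.flip_apply, LinearMap.smul_apply] at this
  simp [this]

theorem correlation_self_le (hB : B.Nondegenerate) (a : F) {y : V} (hy : y ≠ 0) :
    ∑ x, balancedIndicator a (B x y) ^ 2 ≤ Fintype.card V / (Fintype.card F : ℝ) := by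
  have hq : (0 : ℝ) < Fintype.card F := by exact_mod_cast Fintype.card_pos
  have hf : LinearMap.flip B y ≠ 0 := fun h => hy (hB.2 y fun x => by
    simpa using LinearMap.congr_fun h x)
  have := card_mul_sum_comp hf fun s => balancedIndicator a s ^ 2
  simp only [LinearMap.flip_apply] at this
  rw [le_div_iff₀ hq, mul_comm, this]
  exact mul_le_of_le_one_right (by positivity) (sum_balancedIndicator_sq_le a)

open Classical Finset in
theorem card_filter_smul_le {F V : Type*} [Field F] [Fintype F] [AddCommGroup V] [Module F V]
    (E : Finset V) (y : V) :
    (E.filter fun y' => ∃ r : F, y' = r • y).card ≤ Fintype.card F := by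
  have : (E.filter fun y' => ∃ r : F, y' = r • y) ⊆ univ.image fun r : F => r • y := by
    intro y' hy'
    obtain ⟨r, hr⟩ := (mem_filter.mp hy').2
    exact mem_image.mpr ⟨r, mem_univ _, hr.symm⟩
  exact (card_le_card this).trans card_image_le

/-- For `a = 0` the factor `q` lost against `variance_le_of_ne_zero` is genuine: proportional
vectors have the same orthogonal complement. -/
theorem variance_le (hB : B.Nondegenerate) {E : Finset V} (hE : (0 : V) ∉ E) (a : F) :
    ∑ x, (sliceCard B E a x - E.card / Fintype.card F) ^ 2 ≤ E.card * Fintype.card V := by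
  classical
  have hq : (0 : ℝ) < Fintype.card F := by exact_mod_cast Fintype.card_pos
  rw [sum_sliceCard_sub_sq, ← nsmul_eq_mul]
  refine Finset.sum_le_card_nsmul _ _ _ fun y hy => ?_
  have hne : ∀ z ∈ E, z ≠ 0 := fun z hz h => hE (h ▸ hz)
  calc ∑ y' ∈ E, ∑ x, balancedIndicator a (B x y) * balancedIndicator a (B x y')
      ≤ ∑ y' ∈ E, if ∃ r : F, y' = r • y then Fintype.card V / (Fintype.card F : ℝ) else 0 := by
        refine Finset.sum_le_sum fun y' hy' => ?_
        split_ifs with h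
        · have h1 := correlation_self_le hB a (hne y hy)
          have h2 := correlation_self_le hB a (hne y' hy')
          have h3 : ∑ x, balancedIndicator a (B x y) * balancedIndicator a (B x y') ≤
              ∑ x, (balancedIndicator a (B x y) ^ 2 + balancedIndicator a (B x y') ^ 2) / 2 :=
            Finset.sum_le_sum fun x _ => by
              linarith [two_mul_le_add_sq (balancedIndicator a (B x y))
                (balancedIndicator a (B x y'))]
          rw [← Finset.sum_div, Finset.sum_add_distrib] at h3
          linarith
        · push Not at h
          exact (correlation_eq_zero hB h).le
    _ ≤ Fintype.card V := by
        rw [← Finset.sum_filter, Finset.sum_const, nsmul_eq_mul]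
        calc _ ≤ (Fintype.card F : ℝ) * (Fintype.card V / (Fintype.card F : ℝ)) := by
              gcongr; exact card_filter_smul_le (F := F) E y
          _ = _ := by field_simp

theorem variance_le_of_ne_zero (hB : B.Nondegenerate) {E : Finset V} (hE : (0 : V) ∉ E) {a : F}
    (ha : a ≠ 0) :
    ∑ x, (sliceCard B E a x - E.card / Fintype.card F) ^ 2 ≤
      E.card * (2 * (Fintype.card V / Fintype.card F)) := by
  classical
  have hq : (0 : ℝ) < Fintype.card F := by exact_mod_cast Fintype.card_pos
  rw [sum_sliceCard_sub_sq, ← nsmul_eq_mul]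
  refine Finset.sum_le_card_nsmul _ _ _ fun y hy => ?_
  have hy0 : y ≠ 0 := fun h => hE (h ▸ hy)
  calc ∑ y' ∈ E, ∑ x, balancedIndicator a (B x y) * balancedIndicator a (B x y')
      ≤ ∑ y' ∈ E, ((if y' = y then Fintype.card V / (Fintype.card F : ℝ) else 0) +
          if ∃ r : F, y' = r • y then Fintype.card V / (Fintype.card F : ℝ) ^ 2 else 0) := by
        refine Finset.sum_le_sum fun y' hy' => ?_
        by_cases h : ∃ r : F, y' = r • y
        · by_cases hyy : y' = y
          · subst hyy
            have h1 := correlation_self_le hB a hy0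
            simp only [if_true, if_pos h, ← sq]
            have : 0 ≤ Fintype.card V / (Fintype.card F : ℝ) ^ 2 := by positivity
            linarith
          · rw [if_neg hyy, if_pos h, zero_add, div_eq_mul_one_div, ← nsmul_eq_mul]
            refine Finset.sum_le_card_nsmul _ _ _ fun x _ => ?_
            obtain ⟨r, rfl⟩ := h
            -- `B x y` and `B x (r • y)` cannot both equal `a ≠ 0`, as `r ≠ 1`
            have hr : ¬ (B x y = a ∧ B x (r • y) = a) := by
              rintro ⟨h1, h2⟩
              rw [map_smul, h1, smul_eq_mul] at h2
              exact hyy (by rw [(mul_eq_right₀ ha).mp h2, one_smul])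
            have hq1 : 1 / (Fintype.card F : ℝ) ≤ 1 := by
              rw [div_le_one hq]; exact_mod_cast Fintype.card_pos
            have hq0 : 0 < 1 / (Fintype.card F : ℝ) := by positivity
            have e : 1 / (Fintype.card F : ℝ) ^ 2 = (1 / (Fintype.card F : ℝ)) ^ 2 := by
              rw [div_pow, one_pow]
            rw [e]
            unfold balancedIndicator
            split_ifs with h1 h2 h2
            · exact absurd ⟨h1, h2⟩ hr
            · nlinarith
            · nlinarith
            · nlinarith
        · have hyy : y' ≠ y := fun hyy => h ⟨1, by simp [hyy]⟩
          rw [if_neg h, if_neg hyy]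
          push Not at h
          simpa using (correlation_eq_zero hB h).le
    _ ≤ 2 * (Fintype.card V / Fintype.card F) := by
        rw [Finset.sum_add_distrib, Finset.sum_ite_eq', if_pos hy, ← Finset.sum_filter,
          Finset.sum_const, nsmul_eq_mul, two_mul]
        gcongr
        calc _ ≤ (Fintype.card F : ℝ) * (Fintype.card V / (Fintype.card F : ℝ) ^ 2) := by
              gcongr; exact card_filter_smul_le (F := F) E y
          _ = _ := by field_simp

end Variance

/-! ### Collisions and the number of triples -/

open Finset in
theorem card_sq_le_card_image_mul {α β : Type*} [DecidableEq β] (s : Finset α) (f : α → β) :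
    (s.card : ℝ) ^ 2 ≤
      (s.image f).card * ((s ×ˢ s).filter fun p => f p.1 = f p.2).card := by
  have h1 : s.card = ∑ b ∈ s.image f, (s.filter fun a => f a = b).card :=
    card_eq_sum_card_fiberwise fun a ha => mem_image_of_mem f ha
  have h2 : ((s ×ˢ s).filter fun p => f p.1 = f p.2).card =
      ∑ b ∈ s.image f, (s.filter fun a => f a = b).card ^ 2 := by
    rw [card_eq_sum_card_fiberwise (f := fun p => f p.1) (t := s.image f)]
    · refine sum_congr rfl fun b _ => ?_
      rw [sq, ← card_product]
      congr 1
      ext ⟨x, y⟩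
      simp only [mem_filter, mem_product]
      grind
    · intro p hp
      simp only [coe_filter, mem_product, Set.mem_ofPred_eq] at hp
      exact mem_image_of_mem f hp.1.1
  rw [h2, h1]
  exact_mod_cast sq_sum_le_card_mul_sum_sq

open Classical in
/-- The triples `(B(x,y), B(y,z), B(z,x))` with `x, y, z ∈ E`. -/
noncomputable def tripleSet {F V : Type*} [Field F] [Fintype F] [AddCommGroup V] [Module F V]
    (B : LinearMap.BilinForm F V) (E : Finset V) : Finset (F × F × F) :=
  Finset.univ.filter fun t => ∃ x ∈ E, ∃ y ∈ E, ∃ z ∈ E, t = (B x y, B y z, B z x)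

open Classical in
/-- For a pair `p = (x, y)`, the pairs `(z, z')` in `E × E` whose members form the same triple
with `x` and `y`. -/
noncomputable def collisions {F V : Type*} [Field F] [AddCommGroup V] [Module F V]
    (B : LinearMap.BilinForm F V) (E : Finset V) (p : V × V) : Finset (V × V) :=
  (E ×ˢ E).filter fun z => B p.2 (z.1 - z.2) = 0 ∧ B (z.1 - z.2) p.1 = 0

section Counting

variable {F V : Type*} [Field F] [Fintype F] [AddCommGroup V] [Module F V]
  {B : LinearMap.BilinForm F V}

open Classical Finset in
theorem card_sq_le_fiber_mul_collisions (E : Finset V) {p : V × V} (hp : p ∈ E ×ˢ E) :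
    (E.card : ℝ) ^ 2 ≤ ((tripleSet B E).filter fun t => t.1 = B p.1 p.2).card *
      (collisions B E p).card := by
  refine (card_sq_le_card_image_mul E fun z => (B p.1 p.2, B p.2 z, B z p.1)).trans ?_
  rw [mem_product] at hp
  gcongr
  · intro t ht
    obtain ⟨z, hz, rfl⟩ := mem_image.mp ht
    simp only [tripleSet, mem_filter, mem_univ, true_and, and_true]
    exact ⟨p.1, hp.1, p.2, hp.2, z, hz, rfl⟩
  · intro z hz
    simp only [collisions, mem_filter, Prod.mk.injEq, true_and, map_sub, LinearMap.sub_apply,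
      sub_eq_zero] at hz ⊢
    exact hz

open Classical Finset in
/-- Each pair `(x, y) ∈ G` with an average number of collisions gives `≫ q²` triples with first
coordinate `B x y`, and `G` cannot be covered by fewer than `≫ q` level sets of `B`. -/
theorem card_tripleSet_ge {E : Finset V} (hE : E.Nonempty) {G : Finset (V × V)}
    (hGE : G ⊆ E ×ˢ E) {K : ℝ} (hK : 0 < K) (hG : (E.card : ℝ) ^ 2 / 2 ≤ G.card)
    (hP : ∀ a : F, ((G.filter fun p => B p.1 p.2 = a).card : ℝ) ≤
      K * E.card ^ 2 / Fintype.card F)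
    (hQ : ∑ p ∈ G, ((collisions B E p).card : ℝ) ≤ K * E.card ^ 4 / Fintype.card F ^ 2) :
    1 / (16 * K ^ 2) * (Fintype.card F : ℝ) ^ 3 ≤ (tripleSet B E).card := by
  have hq : (0 : ℝ) < Fintype.card F := by exact_mod_cast Fintype.card_pos
  have hn : (0 : ℝ) < E.card := by exact_mod_cast hE.card_pos
  set q : ℝ := (Fintype.card F : ℝ)
  set n : ℝ := (E.card : ℝ)
  set L : ℝ := 4 * K * n ^ 2 / q ^ 2 with hL
  have hL0 : 0 < L := by positivity
  set G' := G.filter fun p => ((collisions B E p).card : ℝ) ≤ L with hG'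
  set A := G'.image fun p => B p.1 p.2 with hA
  -- Markov's inequality
  have h1 : n ^ 2 / 4 ≤ G'.card := by
    have hsplit : (G'.card : ℝ) +
        (G.filter fun p => ¬ ((collisions B E p).card : ℝ) ≤ L).card = G.card := by
      exact_mod_cast card_filter_add_card_filter_not (s := G) _
    have hbad : ((G.filter fun p => ¬ ((collisions B E p).card : ℝ) ≤ L).card : ℝ) * L ≤
        K * n ^ 4 / q ^ 2 := by
      rw [← nsmul_eq_mul]
      refine (card_nsmul_le_sum _ _ _ fun p hp => ?_).trans
        ((sum_le_sum_of_subset_of_nonneg (filter_subset _ _) fun _ _ _ => by positivity).trans hQ)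
      exact (not_le.mp (mem_filter.mp hp).2).le
    have e : K * n ^ 4 / q ^ 2 = n ^ 2 / 4 * L := by rw [hL]; field_simp
    rw [e] at hbad
    have := le_of_mul_le_mul_right hbad hL0
    linarith
  have h2 : q / (4 * K) ≤ A.card := by
    have : (G'.card : ℝ) ≤ A.card * (K * n ^ 2 / q) := by
      rw [card_eq_sum_card_image (fun p => B p.1 p.2) G', ← nsmul_eq_mul]
      push_cast
      refine sum_le_card_nsmul _ _ _ fun a _ => le_trans ?_ (hP a)
      gcongr
      exact filter_subset _ _
    have h3 := h1.trans this
    have e : n ^ 2 / 4 = q / (4 * K) * (K * n ^ 2 / q) := by field_simp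
    rw [e] at h3
    exact le_of_mul_le_mul_right h3 (by positivity)
  have h3 : ∀ a ∈ A, q ^ 2 / (4 * K) ≤ ((tripleSet B E).filter fun t => t.1 = a).card := by
    intro a ha
    obtain ⟨p, hp, rfl⟩ := mem_image.mp ha
    have hp' := mem_filter.mp hp
    have h4 := card_sq_le_fiber_mul_collisions (B := B) E (hGE hp'.1)
    have h5 : n ^ 2 ≤ _ := h4.trans (mul_le_mul_of_nonneg_left hp'.2 (by positivity))
    have e : n ^ 2 = q ^ 2 / (4 * K) * L := by rw [hL]; field_simp
    rw [e] at h5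
    exact le_of_mul_le_mul_right h5 hL0
  have h6 : ∑ a ∈ A, (((tripleSet B E).filter fun t => t.1 = a).card : ℝ) ≤
      (tripleSet B E).card := by
    rw [card_eq_sum_card_fiberwise (f := Prod.fst) (s := tripleSet B E) (t := univ) (by simp)]
    push_cast
    exact sum_le_sum_of_subset_of_nonneg (subset_univ _) fun _ _ _ => by positivity
  refine le_trans ?_ ((card_nsmul_le_sum _ _ _ h3).trans h6)
  rw [nsmul_eq_mul]
  calc 1 / (16 * K ^ 2) * q ^ 3 = q / (4 * K) * (q ^ 2 / (4 * K)) := by field_simp; ring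
    _ ≤ _ := by gcongr

/-- Bounds a count `N` by its mean `m` and its variance, without a square root. -/
theorem le_two_mul_add_sq_div (N : ℝ) {m : ℝ} (hm : 0 < m) : N ≤ 2 * m + (N - m) ^ 2 / m := by
  rw [← sub_le_iff_le_add', le_div_iff₀ hm]
  nlinarith [sq_nonneg (2 * N - 3 * m), sq_nonneg m]

open Classical Finset in
theorem card_level_le [Fintype V] {E : Finset V} (hE : E.Nonempty) (a : F) :
    (((E ×ˢ E).filter fun p => B p.1 p.2 = a).card : ℝ) ≤
      2 * E.card ^ 2 / Fintype.card F + Fintype.card F / E.card *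
        ∑ x, (sliceCard B E a x - E.card / Fintype.card F) ^ 2 := by
  have hq : (0 : ℝ) < Fintype.card F := by exact_mod_cast Fintype.card_pos
  have hn : (0 : ℝ) < E.card := by exact_mod_cast hE.card_pos
  have h1 : (((E ×ˢ E).filter fun p => B p.1 p.2 = a).card : ℝ) = ∑ x ∈ E, sliceCard B E a x := by
    simp only [card_filter, sum_product, sliceCard]
    push_cast
    rfl
  rw [h1]
  calc ∑ x ∈ E, sliceCard B E a x
      ≤ ∑ x ∈ E, (2 * (E.card / Fintype.card F) +
        (sliceCard B E a x - E.card / Fintype.card F) ^ 2 / (E.card / Fintype.card F)) :=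
        sum_le_sum fun x _ => le_two_mul_add_sq_div _ (by positivity)
    _ = 2 * E.card ^ 2 / Fintype.card F + Fintype.card F / E.card *
        ∑ x ∈ E, (sliceCard B E a x - E.card / Fintype.card F) ^ 2 := by
        rw [sum_add_distrib, sum_const, nsmul_eq_mul, ← sum_div]
        field_simp
    _ ≤ _ := by
        gcongr
        exact subset_univ E

end Counting

/-! ### Counting collisions -/

open Classical in
/-- For `w = z - z'`, these are the pairs `(x, y)` in `E × E` with which `z` and `z'` collide. -/
noncomputable def perpPairs {F V : Type*} [Field F] [AddCommGroup V] [Module F V]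
    (B : LinearMap.BilinForm F V) (E : Finset V) (w : V) : Finset (V × V) :=
  (E ×ˢ E).filter fun p => B p.2 w = 0 ∧ B w p.1 = 0

section PerpPairs

variable {F V : Type*} [Field F] [AddCommGroup V] [Module F V]
  {B : LinearMap.BilinForm F V}

theorem perpPairs_smul (E : Finset V) {c : F} (hc : c ≠ 0) (w : V) :
    perpPairs B E (c • w) = perpPairs B E w := by
  ext p
  simp [perpPairs, hc]

open Classical Finset in
theorem sum_card_collisions {E : Finset V} {G : Finset (V × V)} (hG : G ⊆ E ×ˢ E) :
    ∑ p ∈ G, ((collisions B E p).card : ℝ) =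
      ∑ z ∈ E ×ˢ E, ((G.filter fun p => p ∈ perpPairs B E (z.1 - z.2)).card : ℝ) := by
  have h : ∀ p ∈ G, ∀ z : V × V,
      p ∈ perpPairs B E (z.1 - z.2) ↔ B p.2 (z.1 - z.2) = 0 ∧ B (z.1 - z.2) p.1 = 0 :=
    fun p hp z => by simp only [perpPairs, mem_filter, hG hp, true_and]
  have := sum_card_bipartiteAbove_eq_sum_card_bipartiteBelow (s := G) (t := E ×ˢ E)
    fun p z => p ∈ perpPairs B E (z.1 - z.2)
  simp only [bipartiteAbove, bipartiteBelow] at this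
  rw [← Nat.cast_sum, ← Nat.cast_sum, ← this]
  congr 1
  refine sum_congr rfl fun p hp => ?_
  simp only [h p hp, collisions]

open Classical Finset in
theorem card_filter_ne_zero_level_le {E : Finset V} {G : Finset (V × V)} {K : ℝ} (hK : 0 ≤ K)
    (hG : G ⊆ (E ×ˢ E).filter fun p => B p.1 p.2 ≠ 0)
    (h : ∀ a ≠ 0, (((E ×ˢ E).filter fun p => B p.1 p.2 = a).card : ℝ) ≤ K) (a : F) :
    ((G.filter fun p => B p.1 p.2 = a).card : ℝ) ≤ K := by
  by_cases ha : a = 0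
  · subst ha
    rw [filter_false_of_mem fun p hp => (mem_filter.mp (hG hp)).2]
    simpa using hK
  · refine le_trans ?_ (h a ha)
    gcongr
    exact hG.trans (filter_subset _ _)

variable [Fintype F]

/-- The sum of the squared deviations, from their mean, of the sizes of the left and right
orthogonal complements of `w` in `E`. -/
noncomputable def perpDeviation (B : LinearMap.BilinForm F V) (E : Finset V) (w : V) : ℝ :=
  (sliceCard B E 0 w - E.card / Fintype.card F) ^ 2 +
    (sliceCard (LinearMap.flip B) E 0 w - E.card / Fintype.card F) ^ 2

theorem perpDeviation_nonneg (E : Finset V) (w : V) : 0 ≤ perpDeviation B E w := by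
  unfold perpDeviation; positivity

open Classical Finset in
theorem card_perpPairs_le (E : Finset V) (w : V) :
    ((perpPairs B E w).card : ℝ) ≤
      2 * (E.card / Fintype.card F) ^ 2 + perpDeviation B E w := by
  have h : ((perpPairs B E w).card : ℝ) =
      sliceCard B E 0 w * sliceCard (LinearMap.flip B) E 0 w := by
    have : perpPairs B E w =
        (E.filter fun x => B w x = 0) ×ˢ (E.filter fun y => B y w = 0) := by
      ext p
      simp only [perpPairs, mem_filter, mem_product]
      tauto
    rw [this, card_product]
    push_cast
    simp only [sliceCard, LinearMap.flip_apply]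
    congr!
  rw [h]
  unfold perpDeviation
  generalize sliceCard B E 0 w = a
  generalize sliceCard (LinearMap.flip B) E 0 w = b
  generalize (E.card : ℝ) / Fintype.card F = m
  nlinarith [sq_nonneg (a - b), sq_nonneg (a - 2 * m), sq_nonneg (b - 2 * m)]

/-- More than four times the expected number `n² / q²` of pairs `(x, y)` in `E × E` is
orthogonal to `w`. -/
def IsRich (B : LinearMap.BilinForm F V) (E : Finset V) (w : V) : Prop :=
  4 * (E.card / Fintype.card F : ℝ) ^ 2 < (perpPairs B E w).card

open Classical Finset in
theorem sum_card_collisions_le_of_not_rich {E : Finset V} {G : Finset (V × V)}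
    (hG : G ⊆ E ×ˢ E) (hr : ∀ p ∈ G, ∀ w, w ≠ 0 → IsRich B E w → p ∉ perpPairs B E w) :
    ∑ p ∈ G, ((collisions B E p).card : ℝ) ≤
      E.card ^ 3 + 4 * E.card ^ 4 / Fintype.card F ^ 2 := by
  rw [sum_card_collisions hG]
  calc ∑ z ∈ E ×ˢ E, ((G.filter fun p => p ∈ perpPairs B E (z.1 - z.2)).card : ℝ)
      ≤ ∑ z ∈ E ×ˢ E, ((if z.1 = z.2 then (E.card : ℝ) ^ 2 else 0) +
          4 * (E.card / Fintype.card F : ℝ) ^ 2) := by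
        refine sum_le_sum fun z _ => ?_
        split_ifs with hz
        · have : ((G.filter fun p => p ∈ perpPairs B E (z.1 - z.2)).card : ℝ) ≤ E.card ^ 2 := by
            have := card_le_card
              ((filter_subset (fun p => p ∈ perpPairs B E (z.1 - z.2)) G).trans hG)
            rw [card_product, ← sq] at this
            exact_mod_cast this
          have : 0 ≤ 4 * (E.card / Fintype.card F : ℝ) ^ 2 := by positivity
          linarith
        · rw [zero_add]
          by_cases hw : IsRich B E (z.1 - z.2)
          · rw [filter_false_of_mem fun p hp => hr p hp _ (sub_ne_zero.mpr hz) hw]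
            simp only [card_empty, Nat.cast_zero]
            positivity
          · refine le_trans ?_ (not_lt.mp hw)
            gcongr
            intro p hp
            exact (mem_filter.mp hp).2
    _ = _ := by
        rw [sum_add_distrib, sum_product]
        simp only [sum_ite_eq, sum_ite_mem, inter_self, sum_const, card_product, nsmul_eq_mul]
        push_cast
        ring

variable [Fintype V]

theorem sum_perpDeviation_le (hB : B.Nondegenerate) {E : Finset V} (hE : (0 : V) ∉ E) :
    ∑ w, perpDeviation B E w ≤ 2 * (E.card * Fintype.card V) := by
  have h1 := variance_le hB hE 0
  have h2 := variance_le (B := LinearMap.flip B) ⟨hB.2, hB.1⟩ hE 0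
  simp only [perpDeviation, Finset.sum_add_distrib]
  linarith

open Classical Finset in
theorem sum_card_collisions_le (hB : B.Nondegenerate) {E : Finset V} (hE : (0 : V) ∉ E)
    {G : Finset (V × V)} (hG : G ⊆ E ×ˢ E) :
    ∑ p ∈ G, ((collisions B E p).card : ℝ) ≤
      2 * E.card ^ 4 / Fintype.card F ^ 2 + 2 * E.card ^ 2 * Fintype.card V := by
  rw [sum_card_collisions hG]
  have h1 : ∀ z ∈ E, ∑ z' ∈ E, perpDeviation B E (z - z') ≤ 2 * (E.card * Fintype.card V) := by
    intro z _
    -- for fixed `z` the differences `z - z'` are distinct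
    refine le_trans ?_ (sum_perpDeviation_le hB hE)
    rw [← (Equiv.subLeft z).sum_comp]
    exact sum_le_sum_of_subset_of_nonneg (subset_univ _) fun _ _ _ => perpDeviation_nonneg _ _
  calc ∑ z ∈ E ×ˢ E, ((G.filter fun p => p ∈ perpPairs B E (z.1 - z.2)).card : ℝ)
      ≤ ∑ z ∈ E ×ˢ E, (2 * (E.card / Fintype.card F : ℝ) ^ 2 +
          perpDeviation B E (z.1 - z.2)) := by
        refine sum_le_sum fun z _ => le_trans ?_ (card_perpPairs_le E _)
        gcongr
        intro p hp
        exact (mem_filter.mp hp).2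
    _ = E.card ^ 2 * (2 * (E.card / Fintype.card F : ℝ) ^ 2) +
          ∑ z ∈ E, ∑ z' ∈ E, perpDeviation B E (z - z') := by
        rw [sum_add_distrib, sum_const, card_product, nsmul_eq_mul, sum_product]
        push_cast
        ring
    _ ≤ E.card ^ 2 * (2 * (E.card / Fintype.card F : ℝ) ^ 2) +
          E.card • (2 * (E.card * Fintype.card V : ℝ)) := by
        gcongr
        exact sum_le_card_nsmul _ _ _ h1
    _ = _ := by
        rw [nsmul_eq_mul]
        ring

open Classical Finset in
/-- A pair orthogonal to `w` is orthogonal to all `q - 1` multiples of `w`, which saves a factor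
`q` over the trivial count. -/
theorem card_orthogonal_rich_le (hB : B.Nondegenerate) {E : Finset V} (hE : (0 : V) ∉ E) :
    (((E ×ˢ E).filter fun p => ∃ w, w ≠ 0 ∧ IsRich B E w ∧ p ∈ perpPairs B E w).card : ℝ) ≤
      8 * (E.card * Fintype.card V) / Fintype.card F := by
  have hq : (0 : ℝ) < Fintype.card F := by exact_mod_cast Fintype.card_pos
  set bad := (E ×ˢ E).filter fun p => ∃ w, w ≠ 0 ∧ IsRich B E w ∧ p ∈ perpPairs B E w with hbad
  set R : Finset V := univ.filter fun w => w ≠ 0 ∧ IsRich B E w with hR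
  have h1 : ∀ p ∈ bad, Fintype.card Fˣ ≤ (R.filter fun w => p ∈ perpPairs B E w).card := by
    intro p hp
    obtain ⟨w, hw0, hw, hpw⟩ := (mem_filter.mp hp).2
    rw [← card_univ]
    refine card_le_card_of_injOn (fun u : Fˣ => (u : F) • w) (fun u _ => ?_) fun u _ v _ huv => ?_
    · refine mem_coe.mpr (mem_filter.mpr ⟨mem_filter.mpr ⟨mem_univ _,
        smul_ne_zero u.ne_zero hw0, ?_⟩, ?_⟩)
      · rwa [IsRich, perpPairs_smul E u.ne_zero]
      · rwa [perpPairs_smul E u.ne_zero]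
    · exact Units.ext (smul_left_injective F hw0 huv)
  have h2 : bad.card * Fintype.card Fˣ ≤ ∑ w ∈ R, (perpPairs B E w).card := by
    rw [← smul_eq_mul]
    refine (card_nsmul_le_sum _ _ _ h1).trans ?_
    have := sum_card_bipartiteAbove_eq_sum_card_bipartiteBelow (s := bad) (t := R)
      fun p w => p ∈ perpPairs B E w
    simp only [bipartiteAbove, bipartiteBelow] at this
    rw [this]
    gcongr with w
    intro p hp
    exact (mem_filter.mp hp).2
  have h3 : ∑ w ∈ R, ((perpPairs B E w).card : ℝ) ≤ 4 * (E.card * Fintype.card V) := by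
    calc ∑ w ∈ R, ((perpPairs B E w).card : ℝ) ≤ ∑ w ∈ R, 2 * perpDeviation B E w := by
          refine sum_le_sum fun w hw => ?_
          have hr : 4 * (E.card / Fintype.card F : ℝ) ^ 2 < (perpPairs B E w).card :=
            (mem_filter.mp hw).2.2
          have := card_perpPairs_le (B := B) E w
          linarith
      _ ≤ ∑ w, 2 * perpDeviation B E w :=
          sum_le_sum_of_subset_of_nonneg (subset_univ _) fun w _ _ =>
            mul_nonneg zero_le_two (perpDeviation_nonneg _ _)
      _ ≤ _ := by
          rw [← mul_sum]
          linarith [sum_perpDeviation_le hB hE]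
  have h4 : (Fintype.card F : ℝ) ≤ 2 * Fintype.card Fˣ := by
    rw [Fintype.card_units]
    have := Fintype.one_lt_card (α := F)
    exact_mod_cast (by omega : Fintype.card F ≤ 2 * (Fintype.card F - 1))
  have h5 : (bad.card : ℝ) * Fintype.card Fˣ ≤ 4 * (E.card * Fintype.card V) :=
    le_trans (by exact_mod_cast h2) h3
  rw [le_div_iff₀ hq]
  have := mul_le_mul_of_nonneg_left h4 (Nat.cast_nonneg (α := ℝ) bad.card)
  linarith

open Classical Finset in
/-- The zero level set may be too large for `card_tripleSet_ge`, but is small enough to be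
discarded. -/
theorem level_bounds (hB : B.Nondegenerate) {E : Finset V} (hE : (0 : V) ∉ E) (hne : E.Nonempty)
    (hq : 16 ≤ Fintype.card F)
    (h : 16 * (Fintype.card F * Fintype.card V : ℝ) ≤ E.card ^ 2) :
    (((E ×ˢ E).filter fun p => B p.1 p.2 = 0).card : ℝ) ≤ E.card ^ 2 / 4 ∧
    ∀ a ≠ 0, (((E ×ˢ E).filter fun p => B p.1 p.2 = a).card : ℝ) ≤
      3 * E.card ^ 2 / Fintype.card F := by
  have hq' : (16 : ℝ) ≤ Fintype.card F := by exact_mod_cast hq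
  have hq0 : (0 : ℝ) < Fintype.card F := by linarith
  have hn : (0 : ℝ) < E.card := by exact_mod_cast hne.card_pos
  constructor
  · refine (card_level_le hne 0).trans ?_
    calc 2 * (E.card : ℝ) ^ 2 / Fintype.card F + Fintype.card F / E.card *
          ∑ x, (sliceCard B E 0 x - E.card / Fintype.card F) ^ 2
        ≤ 2 * (E.card : ℝ) ^ 2 / 16 + Fintype.card F / E.card * (E.card * Fintype.card V) := by
          gcongr
          exact variance_le hB hE 0
      _ = 2 * (E.card : ℝ) ^ 2 / 16 + Fintype.card F * Fintype.card V := by field_simp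
      _ ≤ _ := by linarith [sq_nonneg (E.card : ℝ)]
  · intro a ha
    refine (card_level_le hne a).trans ?_
    calc 2 * (E.card : ℝ) ^ 2 / Fintype.card F + Fintype.card F / E.card *
          ∑ x, (sliceCard B E a x - E.card / Fintype.card F) ^ 2
        ≤ 2 * (E.card : ℝ) ^ 2 / Fintype.card F + Fintype.card F / E.card *
          (E.card * (2 * (Fintype.card V / Fintype.card F))) := by
          gcongr
          exact variance_le_of_ne_zero hB hE ha
      _ = (2 * (E.card : ℝ) ^ 2 + 2 * (Fintype.card F * Fintype.card V)) / Fintype.card F := by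
          field_simp
      _ ≤ _ := by
          gcongr
          linarith [sq_nonneg (E.card : ℝ)]

open Classical Finset in
/-- Sets with `|E| ≫ |V| ^ (1/2) q`. -/
theorem card_tripleSet_ge_of_sq_le (hB : B.Nondegenerate) {E : Finset V} (hE : (0 : V) ∉ E)
    (hne : E.Nonempty) (hq : 16 ≤ Fintype.card F)
    (h : 16 * (Fintype.card F * Fintype.card V : ℝ) ≤ E.card ^ 2) {L : ℝ} (hL : 0 ≤ L)
    (hV : (Fintype.card F : ℝ) ^ 2 * Fintype.card V ≤ L * E.card ^ 2) :
    1 / (16 * (3 + 2 * L) ^ 2) * (Fintype.card F : ℝ) ^ 3 ≤ (tripleSet B E).card := by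
  have hq0 : (0 : ℝ) < Fintype.card F := by exact_mod_cast Fintype.card_pos
  obtain ⟨h0, h1⟩ := level_bounds hB hE hne hq h
  have hsub := filter_subset (fun p => B p.1 p.2 ≠ 0) (E ×ˢ E)
  refine card_tripleSet_ge hne (G := (E ×ˢ E).filter fun p => B p.1 p.2 ≠ 0) hsub
    (by positivity) ?_ ?_ ?_
  · have := card_filter_add_card_filter_not (s := E ×ˢ E) fun p => B p.1 p.2 = 0
    rw [card_product, ← sq] at this
    have h2 : (((E ×ˢ E).filter fun p => B p.1 p.2 = 0).card : ℝ) +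
      ((E ×ˢ E).filter fun p => B p.1 p.2 ≠ 0).card = E.card ^ 2 := by exact_mod_cast this
    linarith [sq_nonneg (E.card : ℝ)]
  · refine card_filter_ne_zero_level_le (by positivity) subset_rfl fun a ha => (h1 a ha).trans ?_
    gcongr
    linarith
  · refine (sum_card_collisions_le hB hE hsub).trans ?_
    rw [le_div_iff₀ (by positivity), add_mul, div_mul_cancel₀ _ (by positivity)]
    have h3 := mul_le_mul_of_nonneg_left hV (by positivity : (0 : ℝ) ≤ 2 * E.card ^ 2)
    have h4 : (0 : ℝ) ≤ E.card ^ 4 := by positivity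
    linarith

open Classical Finset in
/-- Sets with `|E| ≫ |V| / q`. -/
theorem card_tripleSet_ge_of_card_le (hB : B.Nondegenerate) {E : Finset V} (hE : (0 : V) ∉ E)
    (hne : E.Nonempty) (hq : 16 ≤ Fintype.card F)
    (h : 16 * (Fintype.card F * Fintype.card V : ℝ) ≤ E.card ^ 2)
    (hV : 32 * (Fintype.card V : ℝ) ≤ Fintype.card F * E.card)
    (hF : (Fintype.card F : ℝ) ^ 2 ≤ E.card) :
    1 / (16 * 5 ^ 2) * (Fintype.card F : ℝ) ^ 3 ≤ (tripleSet B E).card := by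
  have hq0 : (0 : ℝ) < Fintype.card F := by exact_mod_cast Fintype.card_pos
  obtain ⟨h0, h1⟩ := level_bounds hB hE hne hq h
  set bad := (E ×ˢ E).filter fun p => ∃ w, w ≠ 0 ∧ IsRich B E w ∧ p ∈ perpPairs B E w with hbad
  have hsub' := sdiff_subset (s := (E ×ˢ E).filter fun p => B p.1 p.2 ≠ 0) (t := bad)
  have hsub := hsub'.trans (filter_subset _ _)
  refine card_tripleSet_ge hne hsub (by positivity) ?_ ?_ ?_
  · have := card_filter_add_card_filter_not (s := E ×ˢ E) fun p => B p.1 p.2 = 0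
    rw [card_product, ← sq] at this
    have h2 : (((E ×ˢ E).filter fun p => B p.1 p.2 = 0).card : ℝ) +
      ((E ×ˢ E).filter fun p => B p.1 p.2 ≠ 0).card = E.card ^ 2 := by exact_mod_cast this
    have h3 : (((E ×ˢ E).filter fun p => B p.1 p.2 ≠ 0).card : ℝ) ≤
        (((E ×ˢ E).filter fun p => B p.1 p.2 ≠ 0) \ bad).card + bad.card := by
      exact_mod_cast card_le_card_sdiff_add_card
    have h4 : (bad.card : ℝ) ≤ E.card ^ 2 / 4 := by
      refine (card_orthogonal_rich_le hB hE).trans ?_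
      rw [div_le_iff₀ hq0]
      have := mul_le_mul_of_nonneg_left hV (Nat.cast_nonneg (α := ℝ) E.card)
      linarith
    linarith
  · refine card_filter_ne_zero_level_le (by positivity) hsub' fun a ha => (h1 a ha).trans ?_
    gcongr
    norm_num
  · refine (sum_card_collisions_le_of_not_rich hsub fun p hp w hw hr hpw => ?_).trans ?_
    · exact (mem_sdiff.mp hp).2 (mem_filter.mpr ⟨hsub hp, w, hw, hr, hpw⟩)
    · rw [le_div_iff₀ (by positivity), add_mul, div_mul_cancel₀ _ (by positivity)]
      have := mul_le_mul_of_nonneg_left hF (by positivity : (0 : ℝ) ≤ E.card ^ 3)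
      linarith

end PerpPairs

/-! ### From sizes to exponents -/

theorem card_tripleSet_le_ncard {F V : Type*} [Field F] [Fintype F] [AddCommGroup V]
    [Module F V] (B : LinearMap.BilinForm F V) {E₀ : Finset V} {E : Set V} (h : ∀ x ∈ E₀, x ∈ E) :
    (tripleSet B E₀).card ≤
      {t : F × F × F | ∃ x ∈ E, ∃ y ∈ E, ∃ z ∈ E, t = (B x y, B y z, B z x)}.ncard := by
  classical
  rw [← Set.ncard_coe_finset]
  refine Set.ncard_le_ncard ?_ (Set.toFinite _)
  intro t ht
  obtain ⟨x, hx, y, hy, z, hz, rfl⟩ := (Finset.mem_filter.mp (Finset.mem_coe.mp ht)).2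
  exact ⟨x, h x hx, y, h y hy, z, h z hz, rfl⟩

/-- The exponent `(2d + 1) / 3` is at least `d / 2 + 1` if `d ≥ 4`, and exceeds `d - 1` if `d = 3`,
so that `card_tripleSet_ge_of_sq_le` or `card_tripleSet_ge_of_card_le` applies. -/
theorem card_tripleSet_ge_of_rpow_le {d : ℕ} (hd : 3 ≤ d) {F : Type*} [Field F] [Fintype F]
    {B : LinearMap.BilinForm F (Fin d → F)} (hB : B.Nondegenerate) {E : Finset (Fin d → F)}
    (hE : 0 ∉ E) {C : ℝ} (hC : 0 < C) (hq : 16 ≤ Fintype.card F)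
    (hq1 : 32 / C ≤ (Fintype.card F : ℝ) ^ (1 / 3 : ℝ))
    (hq2 : 16 / C ^ 2 ≤ (Fintype.card F : ℝ) ^ (1 / 3 : ℝ))
    (h : C * (Fintype.card F : ℝ) ^ ((2 * d + 1) / 3 : ℝ) ≤ E.card) :
    1 / (16 * (5 + 2 / C ^ 2) ^ 2) * (Fintype.card F : ℝ) ^ 3 ≤ (tripleSet B E).card := by
  classical
  have hV : (Fintype.card (Fin d → F) : ℝ) = (Fintype.card F : ℝ) ^ d := by simp
  have hq' : (16 : ℝ) ≤ Fintype.card F := by exact_mod_cast hq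
  set q : ℝ := (Fintype.card F : ℝ) with hqdef
  have hq0 : (0 : ℝ) < q := by linarith
  have hq1' : (1 : ℝ) ≤ q := by linarith
  have hn : (0 : ℝ) < E.card := lt_of_lt_of_le (by positivity) h
  have hne : E.Nonempty := Finset.card_pos.mp (by exact_mod_cast hn)
  have hd' : (3 : ℝ) ≤ d := by exact_mod_cast hd
  rw [div_le_iff₀ hC] at hq1
  rw [div_le_iff₀ (by positivity)] at hq2
  have hsq : C ^ 2 * q ^ ((4 * d + 2) / 3 : ℝ) ≤ E.card ^ 2 := by
    have := pow_le_pow_left₀ (by positivity) h 2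
    rw [mul_pow, ← Real.rpow_mul_natCast hq0.le] at this
    have e : ((4 * d + 2) / 3 : ℝ) = (2 * d + 1) / 3 * (2 : ℕ) := by push_cast; ring
    rwa [e]
  have hH : 16 * (q * Fintype.card (Fin d → F)) ≤ (E.card : ℝ) ^ 2 := by
    rw [hV]
    calc 16 * (q * q ^ d) ≤ q ^ (1 / 3 : ℝ) * C ^ 2 * (q * q ^ d) := by gcongr
      _ = C ^ 2 * q ^ (1 / 3 + ((d + 1 : ℕ) : ℝ)) := by
        rw [Real.rpow_add hq0, Real.rpow_natCast]; ring
      _ ≤ C ^ 2 * q ^ ((4 * d + 2) / 3 : ℝ) := by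
        gcongr
        push_cast
        linarith
      _ ≤ _ := hsq
  rcases hd.eq_or_lt with rfl | hd4
  · have h73 : C * q ^ (1 / 3 : ℝ) * q ^ 2 ≤ E.card := by
      refine le_trans (le_of_eq ?_) h
      rw [mul_assoc, ← Real.rpow_natCast q 2, ← Real.rpow_add hq0]
      norm_num
    have h32 : 32 * q ^ 2 ≤ E.card := by
      refine le_trans ?_ h73
      gcongr
      linarith
    refine le_trans ?_ (card_tripleSet_ge_of_card_le hB hE hne hq hH ?_ ?_)
    · gcongr
      linarith [show 0 ≤ 2 / C ^ 2 by positivity]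
    · rw [hV]
      have := mul_le_mul_of_nonneg_left h32 hq0.le
      linarith
    · linarith [sq_nonneg q]
  · have hd4' : (4 : ℝ) ≤ d := by exact_mod_cast hd4
    refine le_trans ?_ (card_tripleSet_ge_of_sq_le hB hE hne hq hH (L := 1 / C ^ 2)
      (by positivity) ?_)
    · have : 2 / C ^ 2 = 2 * (1 / C ^ 2) := by ring
      rw [this]
      gcongr
      norm_num
    · rw [hV, div_mul_eq_mul_div, one_mul, le_div_iff₀ (by positivity)]
      refine le_trans ?_ hsq
      rw [mul_comm, ← hqdef, ← pow_add, ← Real.rpow_natCast q]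
      gcongr
      push_cast
      linarith

theorem theorem2 (d : ℕ) (hd : 3 ≤ d) (C : ℝ) (hC : 0 < C) :
    ∃ c : ℝ, 0 < c ∧
      ∀ (F : Type*) [Field F] [Fintype F]
        (B : LinearMap.BilinForm F (Fin d → F)), B.Nondegenerate →
        ∀ E : Set (Fin d → F),
          C * (Fintype.card F : ℝ) ^ ((d : ℝ) - ((d : ℝ) - 1) / 3) ≤ (E.ncard : ℝ) →
          c * (Fintype.card F : ℝ) ^ 3 ≤
            (({t : F × F × F | ∃ x ∈ E, ∃ y ∈ E, ∃ z ∈ E,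
                t = (B x y, B y z, B z x)}.ncard : ℕ) : ℝ) := by
  set M : ℝ := 64 / C + 64 / C ^ 2 with hM
  have hM0 : 0 < M := by positivity
  set Q : ℝ := 16 + M ^ 3 with hQ
  have hQ0 : 0 < Q := by positivity
  refine ⟨min (1 / Q ^ 3) (1 / (16 * (5 + 2 / (C / 2) ^ 2) ^ 2)), by positivity, ?_⟩
  intro F _ _ B hB E hE
  classical
  have hq0 : (0 : ℝ) < Fintype.card F := by exact_mod_cast Fintype.card_pos
  have hexp : (d : ℝ) - ((d : ℝ) - 1) / 3 = (2 * d + 1) / 3 := by ring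
  rw [hexp] at hE
  rcases le_total (Fintype.card F : ℝ) Q with hsmall | hlarge
  · -- for bounded `q` a single triple suffices
    have hpos : 0 < E.ncard := by
      have : (0 : ℝ) < E.ncard := lt_of_lt_of_le (by positivity) hE
      exact_mod_cast this
    obtain ⟨x, hx⟩ := (Set.ncard_pos (Set.toFinite _)).mp hpos
    have h1 : 1 ≤ {t : F × F × F | ∃ x ∈ E, ∃ y ∈ E, ∃ z ∈ E,
        t = (B x y, B y z, B z x)}.ncard :=
      (Set.ncard_pos (Set.toFinite _)).mpr ⟨_, x, hx, x, hx, x, hx, rfl⟩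
    calc min (1 / Q ^ 3) (1 / (16 * (5 + 2 / (C / 2) ^ 2) ^ 2)) * (Fintype.card F : ℝ) ^ 3
        ≤ 1 / Q ^ 3 * Q ^ 3 := by
          gcongr
          exact min_le_left _ _
      _ = 1 := by field_simp
      _ ≤ _ := by exact_mod_cast h1
  · have ht : M ≤ (Fintype.card F : ℝ) ^ (1 / 3 : ℝ) := by
      have h3 : M ^ (3 : ℝ) ≤ Fintype.card F := by
        rw [show (3 : ℝ) = ((3 : ℕ) : ℝ) by norm_num, Real.rpow_natCast]; linarith
      have := Real.rpow_le_rpow (by positivity) h3 (by norm_num : (0 : ℝ) ≤ 1 / 3)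
      rwa [← Real.rpow_mul hM0.le, show (3 : ℝ) * (1 / 3) = 1 by norm_num, Real.rpow_one] at this
    have h16 : 16 ≤ Fintype.card F := by
      have : (16 : ℝ) ≤ Fintype.card F := by linarith [pow_pos hM0 3]
      exact_mod_cast this
    have hq1 : (1 : ℝ) ≤ Fintype.card F := by exact_mod_cast Fintype.card_pos
    have h64 : 64 / C ≤ M := by
      rw [hM]; linarith [show 0 < 64 / C ^ 2 by positivity]
    have h64' : 64 / C ^ 2 ≤ M := by
      rw [hM]; linarith [show 0 < 64 / C by positivity]
    -- removing the origin costs at most half of `E`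
    have herase : C / 2 * (Fintype.card F : ℝ) ^ ((2 * d + 1) / 3 : ℝ) ≤
        (E.toFinset.erase 0).card := by
      have h2 : 2 ≤ C * (Fintype.card F : ℝ) ^ ((2 * d + 1) / 3 : ℝ) := by
        have h3 : (Fintype.card F : ℝ) ^ (1 / 3 : ℝ) ≤
            (Fintype.card F : ℝ) ^ ((2 * d + 1) / 3 : ℝ) := by
          gcongr
          linarith [show (0 : ℝ) ≤ d by positivity]
        have := (h64.trans ht).trans h3
        rw [div_le_iff₀ hC] at this
        linarith
      have h4 : (E.ncard : ℝ) ≤ (E.toFinset.erase 0).card + 1 := by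
        rw [Set.ncard_eq_toFinset_card']
        exact_mod_cast (by have := Finset.pred_card_le_card_erase (s := E.toFinset) (a := 0); omega)
      linarith
    calc min (1 / Q ^ 3) (1 / (16 * (5 + 2 / (C / 2) ^ 2) ^ 2)) * (Fintype.card F : ℝ) ^ 3
        ≤ 1 / (16 * (5 + 2 / (C / 2) ^ 2) ^ 2) * (Fintype.card F : ℝ) ^ 3 := by
          gcongr
          exact min_le_right _ _
      _ ≤ ((tripleSet B (E.toFinset.erase 0)).card : ℝ) := by
          refine card_tripleSet_ge_of_rpow_le hd hB (Finset.notMem_erase _ _) (by positivity) h16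
            ?_ ?_ herase
          · refine le_trans (le_of_eq ?_) (h64.trans ht)
            ring
          · refine le_trans (le_of_eq ?_) (h64'.trans ht)
            ring
      _ ≤ _ := Nat.cast_le.mpr (card_tripleSet_le_ncard B fun x hx =>
          Set.mem_toFinset.mp (Finset.mem_of_mem_erase hx))
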